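/- A BIDMC is a channel with uniformly distributed input in $\{0,1\}$ and a discrete output alphabet. The LR-profile of a BIDMC $W$ with output $y$ is $P_W(\varepsilon)=\Pr(y\in L_W(\varepsilon))$, $\varepsilon\in[0,1]$, where $L_W(\varepsilon)=\{b:\Pr(y=b\mid 0)/\Pr(y=b\mid 1)=\varepsilon/(1-\varepsilon)\}$; $W\cong W'$ means $P_W=P_{W'}$ on $[0,1]$. $W'$ is a degradation of $W$ if $W'$ is obtained by passing the output of $W$ through a further channel. $\mathrm{B}(\varepsilon)$ is the binary symmetric channel with crossover probability $\varepsilon$, and $\sum_j p_j\mathrm{B}(\varepsilon_j)$ (with $p_j\ge 0$, $\sum_j p_j=1$) is the channel that uses $\mathrm{B}(\varepsilon_j)$ with probability $p_j$ and reveals $j$ to the receiver. $I(W)=\sum_y\sum_{x}\frac12\Pr(y|x)\log_2\frac{\Pr(y|x)}{\frac12\Pr(y|0)+\frac12\Pr(y|1)}$ is the symmetric capacity. A particle $p\mathrm{B}(\varepsilon)$ is compounded from particles $r_a\mathrm{B}(\sigma_a)$, $\sigma_a\in[0,1/2]$, if $p=\sum_a r_a$ and $p\varepsilon=\sum_a r_a\sigma_a$.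 Let $2\le n<m$, $0\le\sigma_1<\dots<\sigma_m\le 1/2$, $q_1,\dots,q_m>0$, $\sum_i q_i=1$, and let $Q\cong\sum_{i=1}^m q_i\mathrm{B}(\sigma_i)$; put $q_0=q_{m+1}=0$. A $2n$-degradation of $Q$ is a degradation of $Q$ that is equivalent to some $\sum_{j=1}^n p_j\mathrm{B}(\varepsilon_j)$. A $2n$-P$^*$-degradation of $Q$ is a channel $\sum_{j=1}^n p_j\mathrm{B}(\varepsilon_j)$ with all $p_j>0$ and $\varepsilon_1<\dots<\varepsilon_n$ for which there are integers $0=i_1<i_2<\dots<i_{n+1}=m+1$ and numbers $0\le s_j\le q_{i_j}$ ($s_1=s_{n+1}=0$) such that for each $j\in\{1,\dots,n\}$ the particle $p_j\mathrm{B}(\varepsilon_j)$ is compounded from $s_j\mathrm{B}(\sigma_{i_j})$, $(q_{i_{j+1}}-s_{j+1})\mathrm{B}(\sigma_{i_{j+1}})$ and the $q_a\mathrm{B}(\sigma_a)$ with $i_j<a<i_{j+1}$, and such that, if $i_{j+1}=i_j+1$, then $s_j=0$ implies $s_{j+1}=0$, $p_j=q_{i_{j+1}}$, $\varepsilon_j=\sigma_{i_{j+1}}$,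 and $s_{j+1}=q_{i_{j+1}}$ implies $s_j=q_{i_j}=p_j$, $\varepsilon_j=\sigma_{i_j}$. Call a $2n$-degradation $W$ of $Q$ C-optimal if $I(W)\ge I(D)$ for every $2n$-P$^*$-degradation $D$ of $Q$. (In particular, every P$^*$-degradation of maximal symmetric capacity among the $2n$-P$^*$-degradations, and every $2n$-degradation of maximal symmetric capacity among all $2n$-degradations, is C-optimal.) Theorem. Let $W$ be a C-optimal $2n$-degradation of $Q$. Then there are integers $1=k_0<k_1<\dots<k_n=m+1$ such that $W\cong D_Q^+(k_1,\dots,k_{n-1})=\sum_{j=1}^n p_j\mathrm{B}(\varepsilon_j)$, where for each $j\in\{1,\dots,n\}$ the particle $p_j\mathrm{B}(\varepsilon_j)$ is compounded from the particles $q_i\mathrm{B}(\sigma_i)$, $k_{j-1}\le i<k_j$; and for each $j\in\{1,\dots,n-1\}$ with $\varepsilon_j>0$, $$\sigma_{k_j-1}<\phi(\varepsilon_j,\varepsilon_{j+1})<\sigma_{k_j},\qquad \phi(\varepsilon_1,\varepsilon_2)=\frac{\ln(\overline{\varepsilon_1}/\overline{\varepsilon_2})}{\ln\big(\overline{\varepsilon_1}\varepsilon_2/(\overline{\varepsilon_2}\varepsilon_1)\big)},\quad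 \overline{\varepsilon}=1-\varepsilon.$$ -/

import Mathlib

open Finset

/-- A channel from `X` to a discrete output alphabet `Y`: `prob a y` is `Pr(y | x = a)`. -/
structure Channel (X Y : Type*) where
  /-- the transition probabilities -/
  prob : X → Y → ℝ
  nonneg : ∀ a y, 0 ≤ prob a y
  hasSum_one : ∀ a, HasSum (prob a) 1

/-- Binary-input discrete memoryless channels with output alphabet `Y`. -/
abbrev BIDMC (Y : Type*) := Channel (Fin 2) Y

namespace Channel

/-- `Pr(y)` for a uniformly distributed input. -/
noncomputable def outputProb {Y : Type*} (W : BIDMC Y) (y : Y) : ℝ :=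
  (W.prob 0 y + W.prob 1 y) / 2

/-- The outputs whose likelihood ratio `Pr(y | 0) / Pr(y | 1)` is `e / (1 - e)`. The equation is
cross-multiplied, so that `e = 1` stands for an infinite ratio. (An output that occurs with
probability zero for both inputs has no likelihood ratio; it belongs to every level set, where it
has no weight.) -/
def lrLevel {Y : Type*} (W : BIDMC Y) (e : ℝ) : Set Y :=
  {y | (1 - e) * W.prob 0 y = e * W.prob 1 y}

/-- The LR-profile `P_W(e) = Pr(y ∈ L_W(e))`. -/
noncomputable def lrProfile {Y : Type*} (W : BIDMC Y) (e : ℝ) : ℝ :=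
  ∑' y, (W.lrLevel e).indicator W.outputProb y

/-- Equivalence of BIDMCs: their LR-profiles coincide on `[0, 1]`. -/
def Equivalent {Y Z : Type*} (W : BIDMC Y) (V : BIDMC Z) : Prop :=
  ∀ e ∈ Set.Icc (0 : ℝ) 1, W.lrProfile e = V.lrProfile e

/-- `W.IsDegradationOf V`: `W` arises from `V` by an intermediate channel applied to the output. -/
def IsDegradationOf {Y Z : Type*} (W : BIDMC Y) (V : BIDMC Z) : Prop :=
  ∃ K : Channel Z Y, ∀ a y, W.prob a y = ∑' z, V.prob a z * K.prob z y

/-- The symmetric capacity `I(W)`. -/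
noncomputable def symmCapacity {Y : Type*} (W : BIDMC Y) : ℝ :=
  ∑' y, ∑ x : Fin 2, 1 / 2 * W.prob x y *
    Real.logb 2 (W.prob x y / (1 / 2 * W.prob 0 y + 1 / 2 * W.prob 1 y))

/-- The binary symmetric channel `B(e)` with crossover probability `e`. -/
noncomputable def bsc (e : Set.Icc (0 : ℝ) 1) : BIDMC (Fin 2) where
  prob a b := if a = b then 1 - (e : ℝ) else (e : ℝ)
  nonneg a b := by
    have h0 := e.2.1
    have h1 := e.2.2
    split_ifs <;> linarith
  hasSum_one a := by
    have h := hasSum_fintype (fun b : Fin 2 => if a = b then 1 - (e : ℝ) else (e : ℝ))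
    have h2 : ∑ b : Fin 2, (if a = b then 1 - (e : ℝ) else (e : ℝ)) = 1 := by
      fin_cases a <;> simp [Fin.sum_univ_two]
    rwa [h2] at h

/-- The random switching channel `∑ j, p j • W j`: the sub-channel `W j` is used with probability
`p j`, and the receiver sees which sub-channel was used. -/
noncomputable def rsc {n : ℕ} {Y : Type*} (p : stdSimplex ℝ (Fin n)) (W : Fin n → BIDMC Y) :
    BIDMC (Fin n × Y) where
  prob a z := p.1 z.1 * (W z.1).prob a z.2
  nonneg a z := mul_nonneg (p.2.1 z.1) ((W z.1).nonneg a z.2)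
  hasSum_one a := by
    have hf : ∀ j, HasSum (fun y => p.1 j * (W j).prob a y) (p.1 j) := fun j => by
      simpa using ((W j).hasSum_one a).mul_left (p.1 j)
    have hs : Summable (fun z : Fin n × Y => p.1 z.1 * (W z.1).prob a z.2) := by
      refine (summable_prod_of_nonneg
        (fun z => mul_nonneg (p.2.1 z.1) ((W z.1).nonneg a z.2))).2 ⟨fun j => (hf j).summable, ?_⟩
      exact (hasSum_fintype _).summable
    have h := hs.hasSum
    rw [hs.tsum_prod' fun j => (hf j).summable] at h
    have e : ∑' j, ∑' y, p.1 j * (W j).prob a y = 1 := by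
      simp_rw [fun j => (hf j).tsum_eq]
      rw [tsum_fintype]
      exact p.2.2
    rwa [e] at h

/-- `∑ j, p j • B(ε j)`. -/
noncomputable def bscMix {n : ℕ} (p : stdSimplex ℝ (Fin n)) (ε : Fin n → Set.Icc (0 : ℝ) 1) :
    BIDMC (Fin n × Fin 2) :=
  rsc p fun j => bsc (ε j)

/-- `W` is equivalent to a random switching channel of `n` binary symmetric channels. (Such a
channel is symmetric.) -/
def IsBSCMixture {Y : Type*} (n : ℕ) (W : BIDMC Y) : Prop :=
  ∃ (p : stdSimplex ℝ (Fin n)) (ε : Fin n → Set.Icc (0 : ℝ) 1), W.Equivalent (bscMix p ε)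

end Channel

/-- The `a`-th entry `x_a` of the list `x_1, …, x_m`, with `x_a = 0` for `a = 0` and `a > m`. -/
noncomputable def nth {m : ℕ} (x : Fin m → ℝ) (a : ℕ) : ℝ :=
  if h : 1 ≤ a ∧ a ≤ m then x ⟨a - 1, by omega⟩ else 0

/-- The particle `p B(ε)` is compounded from the particles `k a • B(σ a)`, `a ∈ S`. -/
def IsCompounded (p ε : ℝ) (S : Finset ℕ) (k σ : ℕ → ℝ) : Prop :=
  (∀ a ∈ S, 0 ≤ σ a ∧ σ a ≤ 1 / 2) ∧ p = ∑ a ∈ S, k a ∧ p * ε = ∑ a ∈ S, k a * σ a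

/-- The weights of the `(l, l'; t, t')`-segment of a channel with weights `q`: weight `t` at `l`,
weight `q l' - t'` at `l'`, and full weights in between. -/
noncomputable def segmentWeight (q : ℕ → ℝ) (l l' : ℕ) (t t' : ℝ) (a : ℕ) : ℝ :=
  if a = l then t else if a = l' then q l' - t' else if l < a ∧ a < l' then q a else 0

/-- `∑ j, p j • B(ε j)` is a `2n`-P*-degradation of `∑ i, q i • B(σ i)`. The boundary between the
consecutive particles `j - 1` and `j` has the splitting pattern `(i j, s j)`: the weight of the
particle number `i j` is divided, `s j` of it going to the upper side. -/
def IsPStarDegradation {m n : ℕ} (q σ : Fin m → ℝ) (p ε : Fin n → ℝ) : Prop :=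
  ∃ (i : Fin (n + 1) → ℕ) (s : Fin (n + 1) → ℝ),
    i 0 = 0 ∧ i (Fin.last n) = m + 1 ∧ StrictMono i ∧
    s 0 = 0 ∧ s (Fin.last n) = 0 ∧ (∀ j, 0 ≤ s j ∧ s j ≤ nth q (i j)) ∧
    (∀ j : Fin n, IsCompounded (p j) (ε j) (Icc (i j.castSucc) (i j.succ))
      (segmentWeight (nth q) (i j.castSucc) (i j.succ) (s j.castSucc) (s j.succ)) (nth σ)) ∧
    (∀ j, 0 < p j) ∧ StrictMono ε ∧
    ∀ j : Fin n, i j.succ = i j.castSucc + 1 →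
      (s j.castSucc = 0 →
        s j.succ = 0 ∧ p j = nth q (i j.succ) ∧ ε j = nth σ (i j.succ)) ∧
      (s j.succ = nth q (i j.succ) →
        s j.castSucc = nth q (i j.castSucc) ∧
          p j = nth q (i j.castSucc) ∧ ε j = nth σ (i j.castSucc))

/-- `W` is a C-optimal `2n`-degradation of `Q`, where `Q` is equivalent to `∑ i, q i • B(σ i)`: it
is a degradation of `Q`, equivalent to a random switching channel of `n` binary symmetric channels,
and no `2n`-P*-degradation of `Q` has a larger symmetric capacity (a smaller capacity-loss rate).
`W` is not required to be a P*-degradation itself. Hence both the P*-degradations of least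
capacity-loss rate among all P*-degradations, and the `2n`-degradations of greatest symmetric
capacity among all `2n`-degradations, are C-optimal in this sense. -/
def IsCOptimal {m : ℕ} {X Y : Type*} (n : ℕ) (q : stdSimplex ℝ (Fin m))
    (σ : Fin m → Set.Icc (0 : ℝ) 1) (Q : BIDMC X) (W : BIDMC Y) : Prop :=
  W.IsBSCMixture n ∧ W.IsDegradationOf Q ∧
    ∀ (p : stdSimplex ℝ (Fin n)) (ε : Fin n → Set.Icc (0 : ℝ) 1),
      IsPStarDegradation q.1 (fun i => (σ i : ℝ)) p.1 (fun j => (ε j : ℝ)) →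
        (Channel.bscMix p ε).symmCapacity ≤ W.symmCapacity

/-- `∑ j, p j • B(ε j)` is the channel `D⁺(k 1, …, k (n - 1))` of `∑ i, q i • B(σ i)`: its `j`-th
particle is compounded from the particles with numbers from `k (j - 1)` to `k j - 1`. -/
def IsDPlus {m n : ℕ} (q σ : Fin m → ℝ) (k : Fin (n + 1) → ℕ) (p ε : Fin n → ℝ) : Prop :=
  ∀ j : Fin n,
    IsCompounded (p j) (ε j) (Ico (k j.castSucc) (k j.succ)) (nth q) (nth σ)

/-- The function `φ(ε₁, ε₂)`. -/
noncomputable def phi (e₁ e₂ : ℝ) : ℝ :=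
  Real.log ((1 - e₁) / (1 - e₂)) / Real.log (((1 - e₁) * e₂) / ((1 - e₂) * e₁))

/-!
The proof is one step of Lloyd's algorithm for the entropy. Write `h` for the binary entropy. By
Gibbs' inequality `h x` is at most the cross entropy of `x` relative to any center `e`, which is the
tangent line of `h` at `e`, with equality only for `e = x`. Hence the cost of a clustering of the
points `σ i` never increases if each point moves to the center of least cross entropy and each
center moves to the barycenter of its cluster.

A degradation of `Q` is a coupling of the outputs that preserves the mean of the posterior
probability. After folding the posteriors to `[0, 1/2]` it becomes a fractional clustering of the
`σ i`, and Lloyd's step replaces it by a deterministic clustering of no larger entropy. A clustering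
of least entropy, with its clusters numbered by their centers, is a P*-degradation, so for a
C-optimal `W` all these inequalities are equalities. The strictness in Gibbs' inequality then shows
that the fractional clustering was already a deterministic one of least entropy.

In a clustering of least entropy each point is strictly closer, in cross entropy, to its own center
than to any other one. The tangent lines at `ε₁ < ε₂` meet at `φ(ε₁, ε₂)`, so the clusters are
intervals separated by the values of `φ`.
-/

/-- The cross entropy, in nats, of the Bernoulli distribution with parameter `e` relative to the
one with parameter `x`: as a function of `x`, the tangent line of `Real.binEntropy` at `e`. For
`e = 0` and `e = 1` the value is meaningful only if `Dominates e x`; otherwise the cross entropy is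
infinite, and `Real.log 0 = 0` makes this value junk. -/
noncomputable def binCrossEntropy (e x : ℝ) : ℝ :=
  x * Real.log e⁻¹ + (1 - x) * Real.log (1 - e)⁻¹

/-- Absolute continuity of the Bernoulli distribution with parameter `x` with respect to the one
with parameter `e`. -/
def Dominates (e x : ℝ) : Prop :=
  (e = 0 → x = 0) ∧ (e = 1 → x = 1)

/-- The logarithm of the odds `e / (1 - e)`. -/
noncomputable def logOdds (e : ℝ) : ℝ :=
  Real.log e - Real.log (1 - e)

section BinCrossEntropy

variable {e e' x : ℝ}

theorem dominates_of_mem_Ioo (he : e ∈ Set.Ioo 0 1) (x : ℝ) : Dominates e x :=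
  ⟨fun h => absurd h he.1.ne', fun h => absurd h he.2.ne⟩

theorem mul_log_inv_lt_add_sub (he : 0 ≤ e) (hx : 0 ≤ x) (h : e = 0 → x = 0) (hne : e ≠ x) :
    x * Real.log x⁻¹ < x * Real.log e⁻¹ + (e - x) := by
  have he : 0 < e := he.lt_of_ne fun h0 => hne (h0 ▸ (h h0.symm).symm)
  rcases hx.eq_or_lt with rfl | hx
  · simpa using he
  · have hlog : x * Real.log (e / x) < x * (e / x - 1) := mul_lt_mul_of_pos_left
      (Real.log_lt_sub_one_of_pos (div_pos he hx) (by rwa [Ne, div_eq_one_iff_eq hx.ne'])) hx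
    rw [Real.log_div he.ne' hx.ne', mul_sub_one, mul_div_cancel₀ _ hx.ne'] at hlog
    rw [Real.log_inv, Real.log_inv]
    linarith

theorem binEntropy_lt_binCrossEntropy (he : e ∈ Set.Icc 0 1) (hx : x ∈ Set.Icc 0 1)
    (h : Dominates e x) (hne : e ≠ x) : Real.binEntropy x < binCrossEntropy e x := by
  have h0 := mul_log_inv_lt_add_sub he.1 hx.1 h.1 hne
  have h1 := mul_log_inv_lt_add_sub (sub_nonneg.2 he.2) (sub_nonneg.2 hx.2)
    (fun h' => by linarith [h.2 (by linarith)]) (fun h' => hne (by linarith))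
  unfold Real.binEntropy binCrossEntropy
  linarith

theorem binEntropy_le_binCrossEntropy (he : e ∈ Set.Icc 0 1) (hx : x ∈ Set.Icc 0 1)
    (h : Dominates e x) : Real.binEntropy x ≤ binCrossEntropy e x := by
  rcases eq_or_ne e x with rfl | hne
  · rfl
  · exact (binEntropy_lt_binCrossEntropy he hx h hne).le

theorem binCrossEntropy_eq_sub (e x : ℝ) :
    binCrossEntropy e x = Real.log (1 - e)⁻¹ - x * logOdds e := by
  rw [binCrossEntropy, logOdds, Real.log_inv, Real.log_inv]
  ring

theorem sum_mul_binCrossEntropy {ι : Type*} (S : Finset ι) (w x : ι → ℝ) (e : ℝ) :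
    ∑ i ∈ S, w i * binCrossEntropy e (x i)
      = (∑ i ∈ S, w i) * Real.log (1 - e)⁻¹ - (∑ i ∈ S, w i * x i) * logOdds e := by
  rw [sum_mul, sum_mul, ← sum_sub_distrib]
  exact sum_congr rfl fun i _ => by rw [binCrossEntropy_eq_sub]; ring

theorem logOdds_nonpos (he : e ∈ Set.Icc 0 (1 / 2)) : logOdds e ≤ 0 := by
  rcases he.1.eq_or_lt with rfl | he0
  · simp [logOdds]
  · exact sub_nonpos.2 (Real.log_le_log he0 (by linarith [he.2]))

theorem logOdds_lt_logOdds (he : 0 < e) (h : e < e') (he' : e' < 1) : logOdds e < logOdds e' :=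
  sub_lt_sub (Real.log_lt_log he h) (Real.log_lt_log (sub_pos.2 he') (by linarith))

/-- `φ(e, e')` is the point where the tangent lines of the entropy at `e` and `e'` meet. -/
theorem binCrossEntropy_sub_binCrossEntropy (he : 0 < e) (h : e < e') (he' : e' < 1) (x : ℝ) :
    binCrossEntropy e x - binCrossEntropy e' x
      = (x - phi e e') * (logOdds e' - logOdds e) := by
  have hodds : logOdds e' - logOdds e ≠ 0 := (sub_pos.2 (logOdds_lt_logOdds he h he')).ne'
  have h1 : 1 - e ≠ 0 := by linarith
  have h1' : 1 - e' ≠ 0 := by linarith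
  have h0' : e' ≠ 0 := (he.trans h).ne'
  have hphi : phi e e' = (Real.log (1 - e) - Real.log (1 - e')) / (logOdds e' - logOdds e) := by
    rw [phi, Real.log_div h1 h1', Real.log_div (mul_ne_zero h1 h0') (mul_ne_zero h1' he.ne'),
      Real.log_mul h1 h0', Real.log_mul h1' he.ne', logOdds, logOdds]
    congr 1
    ring
  rw [hphi, sub_mul, div_mul_cancel₀ _ hodds, binCrossEntropy_eq_sub, binCrossEntropy_eq_sub,
    Real.log_inv, Real.log_inv]
  ring

theorem binCrossEntropy_lt_iff_lt_phi (he : 0 < e) (h : e < e') (he' : e' < 1) :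
    binCrossEntropy e x < binCrossEntropy e' x ↔ x < phi e e' := by
  rw [← sub_pos, ← neg_sub, binCrossEntropy_sub_binCrossEntropy he h he', ← neg_mul, neg_sub,
    mul_pos_iff_of_pos_right (sub_pos.2 (logOdds_lt_logOdds he h he')), sub_pos]

theorem binCrossEntropy_lt_iff_phi_lt (he : 0 < e) (h : e < e') (he' : e' < 1) :
    binCrossEntropy e' x < binCrossEntropy e x ↔ phi e e' < x := by
  rw [← sub_pos, binCrossEntropy_sub_binCrossEntropy he h he',
    mul_pos_iff_of_pos_right (sub_pos.2 (logOdds_lt_logOdds he h he')), sub_pos]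

end BinCrossEntropy

section Clustering

variable {ι κ : Type*} [Fintype ι] [DecidableEq κ]

/-- The total weight of the cluster `j` of the clustering `s`, which assigns the label `s i` to the
point number `i`. -/
noncomputable def clusterMass (q : ι → ℝ) (s : ι → κ) (j : κ) : ℝ :=
  ∑ i with s i = j, q i

/-- The barycenter of the cluster `j` of the points `σ i` with weights `q i`; it is `0` for a
cluster without weight. -/
noncomputable def clusterMean (q σ : ι → ℝ) (s : ι → κ) (j : κ) : ℝ :=
  clusterMass (fun i => q i * σ i) s j / clusterMass q s j

/-- The cost of the clustering `s` if the center `e j` represents the cluster `j` and the cost of a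
point is its cross entropy relative to the center. -/
noncomputable def clusterCost (q σ : ι → ℝ) (e : κ → ℝ) (s : ι → κ) : ℝ :=
  ∑ i, q i * binCrossEntropy (e (s i)) (σ i)

/-- The conditional entropy of the channel input, in nats, that is left when the particles
`q i B(σ i)` are compounded along the clustering `s`. -/
noncomputable def clusterEntropy [Fintype κ] (q σ : ι → ℝ) (s : ι → κ) : ℝ :=
  ∑ j, clusterMass q s j * Real.binEntropy (clusterMean q σ s j)

/-- The clustering `s` has the least entropy among all clusterings with the same labels. -/
def IsMinClustering [Fintype κ] (q σ : ι → ℝ) (s : ι → κ) : Prop :=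
  ∀ s' : ι → κ, clusterEntropy q σ s ≤ clusterEntropy q σ s'

variable {q σ : ι → ℝ} {s : ι → κ} {e : κ → ℝ}

theorem clusterMass_nonneg (hq : ∀ i, 0 ≤ q i) (s : ι → κ) (j : κ) : 0 ≤ clusterMass q s j :=
  sum_nonneg fun i _ => hq i

theorem clusterMass_pos (hq : ∀ i, 0 < q i) (s : ι → κ) (i : ι) : 0 < clusterMass q s (s i) :=
  sum_pos (fun i _ => hq i) ⟨i, by simp⟩

theorem clusterMass_eq_zero {j : κ} (h : ∀ i, s i ≠ j) (q : ι → ℝ) : clusterMass q s j = 0 := by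
  simp [clusterMass, h]

theorem clusterMass_update [DecidableEq ι] {i : ι} {j : κ} (h : s i ≠ j) (w : ι → ℝ) :
    clusterMass w (Function.update s i j) j = clusterMass w s j + w i := by
  have hset : (univ.filter fun l => Function.update s i j l = j)
      = insert i (univ.filter fun l => s l = j) := by
    ext l
    rcases eq_or_ne l i with rfl | hl
    · simp
    · simp [hl]
  rw [clusterMass, hset, sum_insert (by simpa using h), clusterMass, add_comm]

theorem clusterMass_perm (w : ι → ℝ) (s : ι → κ) (π : Equiv.Perm κ) (j : κ) :
    clusterMass w (π.symm ∘ s) j = clusterMass w s (π j) := by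
  simp only [clusterMass, Function.comp_apply, Equiv.symm_apply_eq]

theorem sum_clusterMass [Fintype κ] (w : ι → ℝ) (s : ι → κ) :
    ∑ j, clusterMass w s j = ∑ i, w i :=
  sum_fiberwise _ _ _

theorem clusterMass_mul_clusterMean (hq : ∀ i, 0 ≤ q i) (σ : ι → ℝ) (s : ι → κ) (j : κ) :
    clusterMass q s j * clusterMean q σ s j = clusterMass (fun i => q i * σ i) s j := by
  rcases eq_or_ne (clusterMass q s j) 0 with h | h
  · have hzero := (sum_eq_zero_iff_of_nonneg fun i _ => hq i).1 h
    rw [h, zero_mul, clusterMass, sum_eq_zero fun i hi => by rw [hzero i hi, zero_mul]]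
  · exact mul_div_cancel₀ _ h

theorem clusterMean_mem_Icc {b : ℝ} (hb : 0 ≤ b) (hq : ∀ i, 0 ≤ q i)
    (hσ : ∀ i, σ i ∈ Set.Icc 0 b) (s : ι → κ) (j : κ) : clusterMean q σ s j ∈ Set.Icc 0 b := by
  refine ⟨div_nonneg (clusterMass_nonneg (fun i => mul_nonneg (hq i) (hσ i).1) s j)
    (clusterMass_nonneg hq s j), div_le_of_le_mul₀ (clusterMass_nonneg hq s j) hb ?_⟩
  rw [clusterMass, clusterMass, mul_sum]
  exact sum_le_sum fun i _ => by
    rw [mul_comm b]; exact mul_le_mul_of_nonneg_left (hσ i).2 (hq i)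

theorem clusterMean_perm (q σ : ι → ℝ) (s : ι → κ) (π : Equiv.Perm κ) (j : κ) :
    clusterMean q σ (π.symm ∘ s) j = clusterMean q σ s (π j) := by
  simp only [clusterMean, clusterMass_perm]

theorem clusterEntropy_perm [Fintype κ] (q σ : ι → ℝ) (s : ι → κ) (π : Equiv.Perm κ) :
    clusterEntropy q σ (π.symm ∘ s) = clusterEntropy q σ s := by
  simp only [clusterEntropy, clusterMass_perm, clusterMean_perm]
  exact Equiv.sum_comp π fun j => clusterMass q s j * Real.binEntropy (clusterMean q σ s j)

theorem eq_of_clusterMean_update_eq [DecidableEq ι] (hq : ∀ i, 0 < q i) {i : ι} {j : κ}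
    (h : s i ≠ j) (hmean : clusterMean q σ (Function.update s i j) j = clusterMean q σ s j) :
    clusterMean q σ s j = σ i := by
  have hq' : ∀ i, 0 ≤ q i := fun i => (hq i).le
  have hsum := clusterMass_mul_clusterMean hq' σ (Function.update s i j) j
  rw [hmean, clusterMass_update h, clusterMass_update h, ← clusterMass_mul_clusterMean hq' σ s j]
    at hsum
  exact mul_left_cancel₀ (hq i).ne' (by linarith)

theorem dominates_clusterMean (hq : ∀ i, 0 < q i) (hσ : ∀ i, σ i ∈ Set.Icc 0 1) (s : ι → κ)
    (i : ι) : Dominates (clusterMean q σ s (s i)) (σ i) := by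
  have hmean := clusterMass_mul_clusterMean (fun i => (hq i).le) σ s (s i)
  have eq_zero : ∀ x : ι → ℝ, (∀ l, 0 ≤ x l) → clusterMass (fun l => q l * x l) s (s i) = 0 →
      x i = 0 := fun x hx h =>
    (mul_eq_zero.1 ((sum_eq_zero_iff_of_nonneg fun l _ => mul_nonneg (hq l).le (hx l)).1 h i
      (by simp))).resolve_left (hq i).ne'
  refine ⟨fun h => eq_zero σ (fun l => (hσ l).1) (by rw [← hmean, h, mul_zero]), fun h => ?_⟩
  have h1 := eq_zero (fun l => 1 - σ l) (fun l => sub_nonneg.2 (hσ l).2) (by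
    simp only [clusterMass, mul_one_sub, sum_sub_distrib] at hmean ⊢
    rw [← hmean, h, mul_one, sub_self])
  linarith

theorem Dominates.clusterMean (hq : ∀ i, 0 < q i) {i : ι} {c : ℝ}
    (h : ∀ l, s l = s i → Dominates c (σ l)) : Dominates c (clusterMean q σ s (s i)) := by
  have eq_mul : ∀ x, (∀ l, s l = s i → σ l = x) →
      clusterMass (fun l => q l * σ l) s (s i) = clusterMass q s (s i) * x := fun x hx => by
    rw [clusterMass, clusterMass, sum_mul]
    exact sum_congr rfl fun l hl => by rw [hx l (mem_filter.1 hl).2]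
  constructor
  · intro hc
    rw [_root_.clusterMean, eq_mul 0 fun l hl => (h l hl).1 hc, mul_zero, zero_div]
  · intro hc
    rw [_root_.clusterMean, eq_mul 1 fun l hl => (h l hl).2 hc, mul_one,
      div_self (clusterMass_pos hq s i).ne']

theorem clusterMass_mul_binEntropy_le (hq : ∀ i, 0 < q i) (hσ : ∀ i, σ i ∈ Set.Icc 0 1)
    (he : ∀ j, e j ∈ Set.Icc 0 1) (hdom : ∀ i, Dominates (e (s i)) (σ i)) (j : κ) :
    clusterMass q s j * Real.binEntropy (clusterMean q σ s j)
      ≤ clusterMass q s j * binCrossEntropy (e j) (clusterMean q σ s j) := by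
  by_cases hj : ∃ i, s i = j
  · obtain ⟨i, rfl⟩ := hj
    exact mul_le_mul_of_nonneg_left (binEntropy_le_binCrossEntropy (he _)
      (clusterMean_mem_Icc zero_le_one (fun i => (hq i).le) hσ s _)
      (Dominates.clusterMean hq fun l hl => hl ▸ hdom l)) (clusterMass_pos hq s i).le
  · rw [clusterMass_eq_zero (not_exists.1 hj) q, zero_mul, zero_mul]

variable [Fintype κ]

theorem clusterCost_eq_sum_clusterMass (hq : ∀ i, 0 ≤ q i) (σ : ι → ℝ) (e : κ → ℝ)
    (s : ι → κ) :
    clusterCost q σ e s = ∑ j, clusterMass q s j * binCrossEntropy (e j) (clusterMean q σ s j) := by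
  rw [clusterCost, ← sum_fiberwise univ s]
  refine sum_congr rfl fun j _ => ?_
  calc ∑ i with s i = j, q i * binCrossEntropy (e (s i)) (σ i)
      = ∑ i with s i = j, q i * binCrossEntropy (e j) (σ i) :=
        sum_congr rfl fun i hi => by rw [(mem_filter.1 hi).2]
    _ = clusterMass q s j * Real.log (1 - e j)⁻¹
          - clusterMass (fun i => q i * σ i) s j * logOdds (e j) :=
        sum_mul_binCrossEntropy _ _ _ _
    _ = clusterMass q s j * binCrossEntropy (e j) (clusterMean q σ s j) := by
        rw [← clusterMass_mul_clusterMean hq, binCrossEntropy_eq_sub]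
        ring

theorem clusterCost_clusterMean (hq : ∀ i, 0 ≤ q i) (σ : ι → ℝ) (s : ι → κ) :
    clusterCost q σ (clusterMean q σ s) s = clusterEntropy q σ s :=
  clusterCost_eq_sum_clusterMass hq σ _ s

theorem clusterEntropy_le_clusterCost (hq : ∀ i, 0 < q i) (hσ : ∀ i, σ i ∈ Set.Icc 0 1)
    (he : ∀ j, e j ∈ Set.Icc 0 1) (hdom : ∀ i, Dominates (e (s i)) (σ i)) :
    clusterEntropy q σ s ≤ clusterCost q σ e s := by
  rw [clusterCost_eq_sum_clusterMass fun i => (hq i).le]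
  exact sum_le_sum fun j _ => clusterMass_mul_binEntropy_le hq hσ he hdom j

theorem eq_clusterMean_of_clusterCost_le (hq : ∀ i, 0 < q i) (hσ : ∀ i, σ i ∈ Set.Icc 0 1)
    (he : ∀ j, e j ∈ Set.Icc 0 1) (hdom : ∀ i, Dominates (e (s i)) (σ i))
    (hle : clusterCost q σ e s ≤ clusterEntropy q σ s) (i : ι) :
    e (s i) = clusterMean q σ s (s i) := by
  have heq := (clusterEntropy_le_clusterCost hq hσ he hdom).antisymm hle
  rw [clusterCost_eq_sum_clusterMass fun i => (hq i).le, clusterEntropy,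
    sum_eq_sum_iff_of_le fun j _ => clusterMass_mul_binEntropy_le hq hσ he hdom j] at heq
  by_contra hne
  exact (binEntropy_lt_binCrossEntropy (he _)
    (clusterMean_mem_Icc zero_le_one (fun i => (hq i).le) hσ s _)
    (Dominates.clusterMean hq fun l hl => hl ▸ hdom l) hne).ne
    (mul_left_cancel₀ (clusterMass_pos hq s i).ne' (heq (s i) (mem_univ _)))

theorem exists_isMinClustering [Nonempty κ] (q σ : ι → ℝ) :
    ∃ s : ι → κ, IsMinClustering q σ s :=
  Finite.exists_min fun s : ι → κ => clusterEntropy q σ s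

theorem IsMinClustering.exists_perm_strictMono {n : ℕ} {s : ι → Fin n}
    (hs : IsMinClustering q σ s) (hinj : Function.Injective (clusterMean q σ s)) :
    ∃ π : Equiv.Perm (Fin n), IsMinClustering q σ (π.symm ∘ s) ∧
      StrictMono (clusterMean q σ (π.symm ∘ s)) := by
  refine ⟨Tuple.sort (clusterMean q σ s), fun s' => ?_, ?_⟩
  · rw [clusterEntropy_perm]
    exact hs s'
  · rw [funext (clusterMean_perm q σ s _)]
    exact (Tuple.monotone_sort _).strictMono_of_injective (hinj.comp (Equiv.injective _))

variable (hs : IsMinClustering q σ s) (hq : ∀ i, 0 < q i) (hσ : ∀ i, σ i ∈ Set.Icc 0 1)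

include hs hq hσ

theorem IsMinClustering.of_clusterCost_le {s' : ι → κ}
    (he : ∀ j, e j ∈ Set.Icc 0 1) (hdom : ∀ i, Dominates (e (s' i)) (σ i))
    (hle : clusterCost q σ e s' ≤ clusterEntropy q σ s) : IsMinClustering q σ s' :=
  fun s'' => (clusterEntropy_le_clusterCost hq hσ he hdom).trans (hle.trans (hs s''))

theorem IsMinClustering.clusterMean_eq_of_notMem_range {j : κ}
    (hj : ∀ i, s i ≠ j) (i : ι) : clusterMean q σ s (s i) = σ i := by
  -- An empty cluster could take over the point `i` and use it as its center.
  classical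
  by_contra hne
  set c := clusterMean q σ s
  have hcmem := clusterMean_mem_Icc zero_le_one (fun i => (hq i).le) hσ s
  set e : κ → ℝ := Function.update c j (σ i)
  set s' : ι → κ := Function.update s i j
  have hnew : e (s' i) = σ i := by simp [e, s']
  have hold : ∀ l, l ≠ i → e (s' l) = c (s l) := fun l hl => by simp [e, s', hl, hj l]
  have hdom : ∀ l, Dominates (e (s' l)) (σ l) := fun l => by
    rcases eq_or_ne l i with rfl | hl
    · rw [hnew]; exact ⟨id, id⟩
    · rw [hold l hl]; exact dominates_clusterMean hq hσ s l
  have hemem : ∀ l, e l ∈ Set.Icc 0 1 := fun l => by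
    rcases eq_or_ne l j with rfl | hl
    · simpa [e] using hσ i
    · simpa [e, hl] using hcmem l
  have hlt : clusterCost q σ e s' < clusterCost q σ c s := by
    refine sum_lt_sum (fun l _ => ?_) ⟨i, mem_univ i, ?_⟩
    · rcases eq_or_ne l i with rfl | hl
      · rw [hnew]
        exact mul_le_mul_of_nonneg_left (binEntropy_le_binCrossEntropy (hcmem _) (hσ l)
          (dominates_clusterMean hq hσ s l)) (hq l).le
      · rw [hold l hl]
    · rw [hnew]
      exact mul_lt_mul_of_pos_left (binEntropy_lt_binCrossEntropy (hcmem _) (hσ i)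
        (dominates_clusterMean hq hσ s i) hne) (hq i)
  rw [clusterCost_clusterMean fun i => (hq i).le] at hlt
  exact (((clusterEntropy_le_clusterCost hq hσ hemem hdom).trans_lt hlt).trans_le (hs s')).false

variable (hinj : Function.Injective σ) (hcard : Fintype.card κ < Fintype.card ι)

include hinj hcard

theorem IsMinClustering.surjective : Function.Surjective s := by
  intro j
  by_contra! hj
  have hmean := hs.clusterMean_eq_of_notMem_range hq hσ hj
  obtain ⟨i, i', hne, heq⟩ := Fintype.exists_ne_map_eq_of_card_lt s hcard
  exact hne (hinj (by rw [← hmean i, ← hmean i', heq]))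

theorem IsMinClustering.clusterMean_injective : Function.Injective (clusterMean q σ s) := by
  intro j j' hjj
  by_contra hne
  set merged : ι → κ := fun i => if s i = j' then j else s i
  have hcenter : ∀ i, clusterMean q σ s (merged i) = clusterMean q σ s (s i) := fun i => by
    by_cases h : s i = j'
    · simp [merged, h, hjj]
    · simp [merged, h]
  have hmin : IsMinClustering q σ merged :=
    hs.of_clusterCost_le hq hσ (clusterMean_mem_Icc zero_le_one (fun i => (hq i).le) hσ s)
      (fun i => by rw [hcenter]; exact dominates_clusterMean hq hσ s i) (by
        rw [← clusterCost_clusterMean fun i => (hq i).le]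
        simp only [clusterCost, hcenter, le_refl])
  obtain ⟨i, hi⟩ := hmin.surjective hq hσ hinj hcard j'
  by_cases h : s i = j'
  · exact hne (by simpa [merged, h] using hi)
  · simp [merged, h] at hi

theorem IsMinClustering.binCrossEntropy_lt {i : ι} {j : κ} (hj : s i ≠ j)
    (hdom : Dominates (clusterMean q σ s j) (σ i)) :
    binCrossEntropy (clusterMean q σ s (s i)) (σ i)
      < binCrossEntropy (clusterMean q σ s j) (σ i) := by
  -- Otherwise moving the point `i` to the cluster `j` leaves an optimal clustering with the same
  -- centers, and a barycenter that adding a point does not move is that point.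
  classical
  by_contra! hle
  set s' : ι → κ := Function.update s i j
  have hcmem := clusterMean_mem_Icc zero_le_one (fun i => (hq i).le) hσ s
  have hdom' : ∀ l, Dominates (clusterMean q σ s (s' l)) (σ l) := fun l => by
    rcases eq_or_ne l i with rfl | hl
    · simpa [s'] using hdom
    · simpa [s', hl] using dominates_clusterMean hq hσ s l
  have hcost : clusterCost q σ (clusterMean q σ s) s' ≤ clusterEntropy q σ s := by
    rw [← clusterCost_clusterMean fun i => (hq i).le]
    refine sum_le_sum fun l _ => mul_le_mul_of_nonneg_left ?_ (hq l).le
    rcases eq_or_ne l i with rfl | hl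
    · simpa [s'] using hle
    · simp [s', hl]
  have hs'min : IsMinClustering q σ s' := hs.of_clusterCost_le hq hσ hcmem hdom' hcost
  have hmean : clusterMean q σ s = clusterMean q σ s' := funext fun l => by
    obtain ⟨l, rfl⟩ := hs'min.surjective hq hσ hinj hcard l
    exact eq_clusterMean_of_clusterCost_le hq hσ hcmem hdom' (hcost.trans (hs s')) l
  have hmean_j : clusterMean q σ s j = σ i := eq_of_clusterMean_update_eq hq hj (by rw [hmean])
  have hmean_i : clusterMean q σ s (s i) = σ i := by
    rw [hmean]
    exact eq_of_clusterMean_update_eq hq (by simpa [s'] using hj.symm) (by simp [s', hmean])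
  exact hj (hs.clusterMean_injective hq hσ hinj hcard (hmean_i.trans hmean_j.symm))

theorem IsMinClustering.lt_phi {i : ι} {j : κ}
    (hpos : 0 < clusterMean q σ s (s i)) (hlt : clusterMean q σ s (s i) < clusterMean q σ s j)
    (hlt_one : clusterMean q σ s j < 1) :
    σ i < phi (clusterMean q σ s (s i)) (clusterMean q σ s j) :=
  (binCrossEntropy_lt_iff_lt_phi hpos hlt hlt_one).1
    (hs.binCrossEntropy_lt hq hσ hinj hcard (fun h => hlt.ne (congrArg _ h))
      (dominates_of_mem_Ioo ⟨hpos.trans hlt, hlt_one⟩ _))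

theorem IsMinClustering.phi_lt {i : ι} {j : κ}
    (hpos : 0 < clusterMean q σ s j) (hlt : clusterMean q σ s j < clusterMean q σ s (s i))
    (hlt_one : clusterMean q σ s (s i) < 1) :
    phi (clusterMean q σ s j) (clusterMean q σ s (s i)) < σ i :=
  (binCrossEntropy_lt_iff_phi_lt hpos hlt hlt_one).1
    (hs.binCrossEntropy_lt hq hσ hinj hcard (fun h => hlt.ne' (congrArg _ h))
      (dominates_of_mem_Ioo ⟨hpos, hlt.trans hlt_one⟩ _))

theorem IsMinClustering.clusterMean_lt {i i' : ι} (hi : σ i < σ i')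
    (hne : s i ≠ s i') :
    clusterMean q σ s (s i) < clusterMean q σ s (s i') := by
  by_contra! hle
  have hlt : clusterMean q σ s (s i') < clusterMean q σ s (s i) :=
    hle.lt_of_ne fun h => hne (hs.clusterMean_injective hq hσ hinj hcard h.symm)
  have hcmem := clusterMean_mem_Icc zero_le_one (fun i => (hq i).le) hσ s
  have hpos : 0 < clusterMean q σ s (s i') := (hcmem _).1.lt_of_ne fun h => by
    linarith [(hσ i).1, (dominates_clusterMean hq hσ s i').1 h.symm]
  have hlt_one : clusterMean q σ s (s i) < 1 := (hcmem _).2.lt_of_ne fun h => by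
    linarith [(hσ i').2, (dominates_clusterMean hq hσ s i).2 h]
  linarith [hs.lt_phi hq hσ hinj hcard hpos hlt hlt_one,
    hs.phi_lt hq hσ hinj hcard hpos hlt hlt_one]

omit hinj in
theorem IsMinClustering.monotone [LinearOrder ι] [LinearOrder κ] (hmono : StrictMono σ)
    (hmean : StrictMono (clusterMean q σ s)) : Monotone s := by
  refine monotone_iff_forall_lt.2 fun i i' hi => ?_
  rcases eq_or_ne (s i) (s i') with h | h
  · exact h.le
  · exact (hmean.lt_iff_lt.1
      (hs.clusterMean_lt hq hσ hmono.injective hcard (hmono hi) h)).le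

end Clustering

section Coupling

/-- The nonnegative matrix `t` has row sums `p` and column sums `q`. As a transport plan, it moves
the weight `t j i` from the point number `i` to the center number `j`: a fractional clustering. -/
structure IsCoupling {κ ι : Type*} [Fintype κ] [Fintype ι] (t : κ → ι → ℝ) (p : κ → ℝ)
    (q : ι → ℝ) : Prop where
  nonneg : ∀ j i, 0 ≤ t j i
  sum_row : ∀ j, ∑ i, t j i = p j
  sum_col : ∀ i, ∑ j, t j i = q i

/-- The clustering `s` assigns each point `σ i` to a center of least cross entropy. -/
def IsNearestClustering {ι κ : Type*} (σ : ι → ℝ) (e : κ → ℝ) (s : ι → κ) : Prop :=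
  ∀ i, Dominates (e (s i)) (σ i) ∧
    ∀ j, Dominates (e j) (σ i) → binCrossEntropy (e (s i)) (σ i) ≤ binCrossEntropy (e j) (σ i)

variable {ι κ : Type*} {q σ : ι → ℝ} {p e : κ → ℝ} {s : ι → κ}

theorem exists_isNearestClustering [Finite κ] (h : ∀ i, ∃ j, Dominates (e j) (σ i)) :
    ∃ s : ι → κ, IsNearestClustering σ e s := by
  have hmin (i : ι) := Set.exists_min_image {j | Dominates (e j) (σ i)}
    (fun j => binCrossEntropy (e j) (σ i)) (Set.toFinite _) (h i)
  choose s hs using hmin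
  exact ⟨s, hs⟩

variable [Fintype ι] [Fintype κ] {t : κ → ι → ℝ}

namespace IsCoupling

theorem sum_fst {κ' ι' : Type*} [Fintype κ'] [Fintype ι'] {T : κ × κ' → ι × ι' → ℝ}
    {P : κ × κ' → ℝ} {Q : ι × ι' → ℝ} (hT : IsCoupling T P Q) :
    IsCoupling (fun j i => ∑ b', ∑ b, T (j, b') (i, b)) (fun j => ∑ b', P (j, b'))
      (fun i => ∑ b, Q (i, b)) where
  nonneg j i := sum_nonneg fun b' _ => sum_nonneg fun b _ => hT.nonneg _ _
  sum_row j := by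
    rw [sum_comm]
    exact sum_congr rfl fun b' _ => by rw [← hT.sum_row, Fintype.sum_prod_type]
  sum_col i := by
    simp only [← hT.sum_col, Fintype.sum_prod_type]
    rw [sum_congr rfl fun j _ => sum_comm, sum_comm]

variable (ht : IsCoupling t p q)

include ht

theorem sum_sum_mul (f : ι → ℝ) : ∑ j, ∑ i, t j i * f i = ∑ i, q i * f i := by
  rw [sum_comm]
  exact sum_congr rfl fun i _ => by rw [← sum_mul, ht.sum_col]

theorem sum_mul_min_le {x : ι → ℝ} {j : κ} {y : ℝ} (hy : ∑ i, t j i * x i = p j * y) :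
    ∑ i, t j i * min (x i) (1 - x i) ≤ p j * min y (1 - y) := by
  have hp : 0 ≤ p j := ht.sum_row j ▸ sum_nonneg fun i _ => ht.nonneg j i
  rw [mul_min_of_nonneg _ _ hp, mul_one_sub, ← hy, ← ht.sum_row, ← sum_sub_distrib]
  exact le_min
    (sum_le_sum fun i _ => mul_le_mul_of_nonneg_left (min_le_left _ _) (ht.nonneg j i))
    (sum_le_sum fun i _ => by
      rw [← mul_one_sub]; exact mul_le_mul_of_nonneg_left (min_le_right _ _) (ht.nonneg j i))

theorem exists_pos (hq : ∀ i, 0 < q i) (i : ι) : ∃ j, 0 < t j i := by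
  by_contra! h
  exact (hq i).not_ge (ht.sum_col i ▸ sum_nonpos fun j _ => h j)

theorem eq_clusterMass [DecidableEq κ] (h : ∀ j i, s i ≠ j → t j i = 0) :
    p = clusterMass q s := by
  funext j
  rw [← ht.sum_row j, clusterMass, sum_filter]
  refine sum_congr rfl fun i _ => ?_
  split_ifs with hj
  · rw [← ht.sum_col i, sum_eq_single j (fun l _ hl => h l i (hj ▸ hl.symm)) (by simp)]
  · exact h j i hj

theorem dominates (hσ : ∀ i, 0 ≤ σ i) (hmean : ∀ j, ∑ i, t j i * σ i ≤ p j * e j) {j : κ}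
    (hj : e j < 1) {i : ι} (hpos : 0 < t j i) : Dominates (e j) (σ i) := by
  refine ⟨fun h => ?_, fun h => absurd h hj.ne⟩
  have hle : t j i * σ i ≤ 0 := calc
    t j i * σ i ≤ ∑ i, t j i * σ i :=
      single_le_sum (f := fun i => t j i * σ i)
        (fun i _ => mul_nonneg (ht.nonneg j i) (hσ i)) (mem_univ i)
    _ ≤ 0 := by simpa [h] using hmean j
  exact le_antisymm (nonpos_of_mul_nonpos_right hle hpos) (hσ i)

theorem sum_mul_binCrossEntropy_le (he : ∀ j, e j ∈ Set.Icc 0 (1 / 2))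
    (hmean : ∀ j, ∑ i, t j i * σ i ≤ p j * e j) (j : κ) :
    ∑ i, t j i * binCrossEntropy (e j) (σ i) ≤ p j * Real.binEntropy (e j) := calc
  ∑ i, t j i * binCrossEntropy (e j) (σ i)
      = p j * Real.log (1 - e j)⁻¹ - (∑ i, t j i * σ i) * logOdds (e j) := by
        rw [sum_mul_binCrossEntropy, ht.sum_row]
  _ ≤ p j * Real.log (1 - e j)⁻¹ - p j * e j * logOdds (e j) :=
        sub_le_sub_left (mul_le_mul_of_nonpos_right (hmean j) (logOdds_nonpos (he j))) _
  _ = p j * binCrossEntropy (e j) (e j) := by rw [binCrossEntropy_eq_sub]; ring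

section Nearest

variable (hs : IsNearestClustering σ e s) (hdom : ∀ j i, 0 < t j i → Dominates (e j) (σ i))

include hs hdom

theorem mul_binCrossEntropy_le_of_isNearestClustering (j : κ) (i : ι) :
    t j i * binCrossEntropy (e (s i)) (σ i) ≤ t j i * binCrossEntropy (e j) (σ i) := by
  rcases (ht.nonneg j i).eq_or_lt with h | h
  · simp only [← h, zero_mul, le_refl]
  · exact mul_le_mul_of_nonneg_left ((hs i).2 j (hdom j i h)) h.le

theorem clusterCost_le_of_isNearestClustering :
    clusterCost q σ e s ≤ ∑ j, ∑ i, t j i * binCrossEntropy (e j) (σ i) := by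
  rw [clusterCost, ← ht.sum_sum_mul]
  exact sum_le_sum fun j _ => sum_le_sum fun i _ =>
    ht.mul_binCrossEntropy_le_of_isNearestClustering hs hdom j i

theorem mul_binCrossEntropy_eq_of_le_clusterCost
    (hle : ∑ j, ∑ i, t j i * binCrossEntropy (e j) (σ i) ≤ clusterCost q σ e s) (j : κ) (i : ι) :
    t j i * binCrossEntropy (e (s i)) (σ i) = t j i * binCrossEntropy (e j) (σ i) := by
  have hterm := ht.mul_binCrossEntropy_le_of_isNearestClustering hs hdom
  have hsum := (ht.clusterCost_le_of_isNearestClustering hs hdom).antisymm hle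
  rw [clusterCost, ← ht.sum_sum_mul,
    sum_eq_sum_iff_of_le fun j _ => sum_le_sum fun i _ => hterm j i] at hsum
  exact (sum_eq_sum_iff_of_le fun i _ => hterm j i).1 (hsum j (mem_univ j)) i (mem_univ i)

end Nearest

/-- The centers of the fractional clustering `t` may lie above the barycenters, because on
`[0, 1/2]` the tangent lines of the entropy are nondecreasing. -/
theorem exists_isMinClustering [DecidableEq κ] (hq : ∀ i, 0 < q i)
    (hσ : ∀ i, σ i ∈ Set.Icc 0 1) (hinj : Function.Injective σ)
    (hcard : Fintype.card κ < Fintype.card ι) (he : ∀ j, e j ∈ Set.Icc 0 (1 / 2))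
    (hmean : ∀ j, ∑ i, t j i * σ i ≤ p j * e j)
    (hbest : ∀ s : ι → κ, ∑ j, p j * Real.binEntropy (e j) ≤ clusterEntropy q σ s) :
    ∃ s : ι → κ, IsMinClustering q σ s ∧ p = clusterMass q s ∧ e = clusterMean q σ s := by
  have he' : ∀ j, e j ∈ Set.Icc 0 1 := fun j => ⟨(he j).1, by linarith [(he j).2]⟩
  have hdom : ∀ j i, 0 < t j i → Dominates (e j) (σ i) := fun j i =>
    ht.dominates (fun i => (hσ i).1) hmean (by linarith [(he j).2])
  obtain ⟨s, hs⟩ : ∃ s : ι → κ, IsNearestClustering σ e s :=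
    exists_isNearestClustering fun i => (ht.exists_pos hq i).imp fun j => hdom j i
  have hlower : clusterEntropy q σ s ≤ clusterCost q σ e s :=
    clusterEntropy_le_clusterCost hq hσ he' fun i => (hs i).1
  have hreassign := ht.clusterCost_le_of_isNearestClustering hs hdom
  have hupper : ∑ j, ∑ i, t j i * binCrossEntropy (e j) (σ i) ≤ ∑ j, p j * Real.binEntropy (e j) :=
    sum_le_sum fun j _ => ht.sum_mul_binCrossEntropy_le he hmean j
  have hmin : IsMinClustering q σ s := fun s' => by linarith [hbest s']
  have hcenter : e = clusterMean q σ s := funext fun j => by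
    obtain ⟨i, rfl⟩ := hmin.surjective hq hσ hinj hcard j
    exact eq_clusterMean_of_clusterCost_le hq hσ he' (fun i => (hs i).1)
      (by linarith [hbest s]) i
  refine ⟨s, hmin, ht.eq_clusterMass fun j i hj => ?_, hcenter⟩
  by_contra hne
  have hlt := hmin.binCrossEntropy_lt hq hσ hinj hcard hj
    (hcenter ▸ hdom j i ((ht.nonneg j i).lt_of_ne' hne))
  rw [← hcenter] at hlt
  exact hlt.ne (mul_left_cancel₀ hne
    (ht.mul_binCrossEntropy_eq_of_le_clusterCost hs hdom (by linarith [hbest s]) j i))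

end IsCoupling

end Coupling

namespace Channel

section Composition

variable {X Y Z : Type*}

theorem prob_le_one (K : Channel X Y) (x : X) (y : Y) : K.prob x y ≤ 1 :=
  le_hasSum (K.hasSum_one x) y fun y' _ => K.nonneg x y'

theorem summable_mul_prob (K : Channel X Y) {f : X → ℝ} (hf : ∀ x, 0 ≤ f x) (hs : Summable f)
    (y : Y) : Summable fun x => f x * K.prob x y :=
  hs.of_nonneg_of_le (fun x => mul_nonneg (hf x) (K.nonneg x y))
    fun x => mul_le_of_le_one_right (hf x) (K.prob_le_one x y)

theorem hasSum_prod_mul_prob (K : Channel X Y) {f : X → ℝ} {a : ℝ} (hf : ∀ x, 0 ≤ f x)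
    (hs : HasSum f a) : HasSum (fun z : X × Y => f z.1 * K.prob z.1 z.2) a := by
  have hrow : ∀ x, HasSum (fun y => f x * K.prob x y) (f x) := fun x => by
    simpa using (K.hasSum_one x).mul_left (f x)
  have hsummable : Summable fun z : X × Y => f z.1 * K.prob z.1 z.2 := by
    refine (summable_prod_of_nonneg fun z => mul_nonneg (hf z.1) (K.nonneg z.1 z.2)).2
      ⟨fun x => (hrow x).summable, ?_⟩
    simpa only [(hrow _).tsum_eq] using hs.summable
  have hsum := hsummable.hasSum
  rw [hsummable.tsum_prod' fun x => (hrow x).summable] at hsum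
  simpa only [(hrow _).tsum_eq, hs.tsum_eq] using hsum

theorem hasSum_tsum_mul_prob (K : Channel X Y) {f : X → ℝ} {a : ℝ} (hf : ∀ x, 0 ≤ f x)
    (hs : HasSum f a) : HasSum (fun y => ∑' x, f x * K.prob x y) a :=
  ((Equiv.prodComm Y X).hasSum_iff.2 (K.hasSum_prod_mul_prob hf hs)).prod_fiberwise
    fun y => (K.summable_mul_prob hf hs.summable y).hasSum

/-- The concatenation of two channels. -/
noncomputable def comp (K : Channel X Y) (R : Channel Y Z) : Channel X Z where
  prob x z := ∑' y, K.prob x y * R.prob y z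
  nonneg x z := tsum_nonneg fun y => mul_nonneg (K.nonneg x y) (R.nonneg y z)
  hasSum_one x := R.hasSum_tsum_mul_prob (K.nonneg x) (K.hasSum_one x)

theorem tsum_mul_comp (K : Channel X Y) (R : Channel Y Z) {f : X → ℝ} (hf : ∀ x, 0 ≤ f x)
    (hs : Summable f) (z : Z) :
    ∑' x, f x * (K.comp R).prob x z = ∑' y, (∑' x, f x * K.prob x y) * R.prob y z := by
  have hsummable : Summable fun p : X × Y => f p.1 * (K.prob p.1 p.2 * R.prob p.2 z) := by
    refine (K.hasSum_prod_mul_prob hf hs.hasSum).summable.of_nonneg_of_le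
      (fun p => mul_nonneg (hf _) (mul_nonneg (K.nonneg _ _) (R.nonneg _ _))) fun p => ?_
    exact mul_le_mul_of_nonneg_left
      (mul_le_of_le_one_right (K.nonneg _ _) (R.prob_le_one _ _)) (hf _)
  calc ∑' x, f x * (K.comp R).prob x z
      = ∑' x, ∑' y, f x * (K.prob x y * R.prob y z) :=
        tsum_congr fun x => tsum_mul_left.symm
    _ = ∑' y, ∑' x, f x * (K.prob x y * R.prob y z) :=
        Summable.tsum_comm (f := fun y x => f x * (K.prob x y * R.prob y z))
          ((Equiv.prodComm Y X).summable_iff.2 hsummable)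
    _ = ∑' y, (∑' x, f x * K.prob x y) * R.prob y z := tsum_congr fun y => by
        rw [← tsum_mul_right]
        exact tsum_congr fun x => (mul_assoc _ _ _).symm

theorem IsDegradationOf.trans {U : BIDMC X} {V : BIDMC Y} {W : BIDMC Z}
    (h : W.IsDegradationOf V) (h' : V.IsDegradationOf U) : W.IsDegradationOf U := by
  obtain ⟨R, hR⟩ := h
  obtain ⟨K, hK⟩ := h'
  refine ⟨K.comp R, fun a z => ?_⟩
  rw [hR, K.tsum_mul_comp R (U.nonneg a) (U.hasSum_one a).summable]
  simp_rw [hK]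

end Composition

section Posterior

variable {Y Z : Type*}

/-- The posterior probability of the input `0`; it is `0` for an output without probability. -/
noncomputable def posterior (W : BIDMC Y) (y : Y) : ℝ :=
  W.prob 0 y / (W.prob 0 y + W.prob 1 y)

section

variable (W : BIDMC Y)

theorem outputProb_nonneg (y : Y) : 0 ≤ W.outputProb y :=
  div_nonneg (add_nonneg (W.nonneg 0 y) (W.nonneg 1 y)) zero_le_two

theorem hasSum_outputProb : HasSum W.outputProb 1 := by
  have h := ((W.hasSum_one 0).add (W.hasSum_one 1)).div_const 2
  rwa [show ((1 : ℝ) + 1) / 2 = 1 by norm_num] at h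

theorem posterior_mem_Icc (y : Y) : W.posterior y ∈ Set.Icc (0 : ℝ) 1 := by
  have h0 := W.nonneg 0 y
  have h1 := W.nonneg 1 y
  exact ⟨div_nonneg h0 (add_nonneg h0 h1),
    div_le_one_of_le₀ (by linarith) (add_nonneg h0 h1)⟩

theorem prob_zero_eq (y : Y) : W.prob 0 y = 2 * W.posterior y * W.outputProb y := by
  by_cases h : W.prob 0 y + W.prob 1 y = 0
  · have h0 : W.prob 0 y = 0 := by linarith [W.nonneg 0 y, W.nonneg 1 y]
    rw [outputProb, h, h0, zero_div, mul_zero]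
  · unfold posterior outputProb
    field_simp

theorem prob_one_eq (y : Y) : W.prob 1 y = 2 * (1 - W.posterior y) * W.outputProb y := by
  have h0 := W.prob_zero_eq y
  have hsum : W.prob 0 y + W.prob 1 y = 2 * W.outputProb y := by unfold outputProb; ring
  linarith

theorem indicator_lrLevel (e : ℝ) (y : Y) :
    (W.lrLevel e).indicator W.outputProb y = if W.posterior y = e then W.outputProb y else 0 := by
  classical
  by_cases h : W.outputProb y = 0
  · simp [Set.indicator_apply, h]
  · have hmem : y ∈ W.lrLevel e ↔ W.posterior y = e := by
      rw [lrLevel, Set.mem_ofPred_eq, prob_zero_eq, prob_one_eq]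
      refine ⟨fun h' => mul_left_cancel₀ h (by linarith), ?_⟩
      rintro rfl
      ring
    simp only [Set.indicator_apply, hmem]

theorem hasSum_lrProfile (e : ℝ) :
    HasSum (fun y => if W.posterior y = e then W.outputProb y else 0) (W.lrProfile e) := by
  simp only [← indicator_lrLevel]
  exact (W.hasSum_outputProb.summable.indicator _).hasSum

theorem outputProb_le_lrProfile (y : Y) : W.outputProb y ≤ W.lrProfile (W.posterior y) := by
  simpa using le_hasSum (W.hasSum_lrProfile (W.posterior y)) y fun y' _ => by
    split_ifs
    exacts [W.outputProb_nonneg y', le_rfl]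

end

variable {W : BIDMC Y} {V : BIDMC Z}

theorem Equivalent.symm (h : W.Equivalent V) : V.Equivalent W :=
  fun e he => (h e he).symm

theorem Equivalent.trans {X : Type*} {U : BIDMC X} (h : W.Equivalent V) (h' : V.Equivalent U) :
    W.Equivalent U :=
  fun e he => (h e he).trans (h' e he)

theorem Equivalent.of_equiv (π : Y ≃ Z) (h : ∀ a y, W.prob a y = V.prob a (π y)) :
    W.Equivalent V := by
  intro e _
  rw [lrProfile, lrProfile, ← π.tsum_eq]
  refine tsum_congr fun y => ?_
  classical
  simp only [Set.indicator_apply, lrLevel, outputProb, Set.mem_ofPred_eq, h]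

/-- The channel that replaces an output of `W` by a random output of `V` with the same posterior
probability. Outputs of `W` without probability get an arbitrary distribution. -/
noncomputable def Equivalent.resampling (h : W.Equivalent V) : Channel Y Z where
  prob y z := if W.outputProb y = 0 then V.outputProb z else
    (if V.posterior z = W.posterior y then V.outputProb z else 0) / V.lrProfile (W.posterior y)
  nonneg y z := by
    have hprofile : 0 ≤ V.lrProfile (W.posterior y) := by
      rw [← h _ (W.posterior_mem_Icc y)]
      exact (W.outputProb_nonneg y).trans (W.outputProb_le_lrProfile y)
    have hout := V.outputProb_nonneg z
    positivity
  hasSum_one y := by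
    by_cases hy : W.outputProb y = 0
    · simpa only [hy, if_true] using V.hasSum_outputProb
    · have hprofile : V.lrProfile (W.posterior y) ≠ 0 := by
        rw [← h _ (W.posterior_mem_Icc y)]
        exact (((W.outputProb_nonneg y).lt_of_ne' hy).trans_le (W.outputProb_le_lrProfile y)).ne'
      simpa only [hy, if_false, div_self hprofile] using
        (V.hasSum_lrProfile (W.posterior y)).div_const (V.lrProfile (W.posterior y))

theorem Equivalent.outputProb_mul_resampling (h : W.Equivalent V) (y : Y) (z : Z) :
    W.outputProb y * h.resampling.prob y z
      = (if W.posterior y = V.posterior z then W.outputProb y else 0)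
        * (V.outputProb z / V.lrProfile (V.posterior z)) := by
  by_cases hy : W.outputProb y = 0
  · simp only [hy, ite_self, zero_mul]
  · by_cases hz : V.posterior z = W.posterior y
    · simp only [resampling, hy, hz, if_true, if_false]
    · simp only [resampling, hy, hz, Ne.symm hz, if_false, zero_div, mul_zero, zero_mul]

theorem Equivalent.tsum_posterior_mul_resampling (h : W.Equivalent V) (f : ℝ → ℝ) (z : Z) :
    ∑' y, f (W.posterior y) * W.outputProb y * h.resampling.prob y z
      = f (V.posterior z) * V.outputProb z := by
  have hterm : ∀ y, f (W.posterior y) * W.outputProb y * h.resampling.prob y z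
      = f (V.posterior z) * (V.outputProb z / V.lrProfile (V.posterior z))
        * if W.posterior y = V.posterior z then W.outputProb y else 0 := fun y => by
    rw [mul_assoc, h.outputProb_mul_resampling]
    split_ifs with hy
    · rw [hy]; ring
    · ring
  rw [tsum_congr hterm, tsum_mul_left, (W.hasSum_lrProfile _).tsum_eq,
    h _ (V.posterior_mem_Icc z), mul_assoc]
  congr 1
  rcases eq_or_ne (V.lrProfile (V.posterior z)) 0 with hz | hz
  · rw [hz, mul_zero]
    exact (V.outputProb_nonneg z).antisymm ((V.outputProb_le_lrProfile z).trans hz.le)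
  · exact div_mul_cancel₀ _ hz

theorem Equivalent.isDegradationOf (h : W.Equivalent V) : V.IsDegradationOf W := by
  refine ⟨h.resampling, Fin.forall_fin_two.2 ⟨fun z => ?_, fun z => ?_⟩⟩
  · simp only [prob_zero_eq]
    exact (h.tsum_posterior_mul_resampling (fun x => 2 * x) z).symm
  · simp only [prob_one_eq]
    exact (h.tsum_posterior_mul_resampling (fun x => 2 * (1 - x)) z).symm

theorem Equivalent.tsum_posterior_mul_outputProb (h : W.Equivalent V) {f : ℝ → ℝ} {C : ℝ}
    (hf : ∀ x ∈ Set.Icc 0 1, f x ∈ Set.Icc 0 C) :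
    ∑' y, f (W.posterior y) * W.outputProb y = ∑' z, f (V.posterior z) * V.outputProb z := by
  have hmem : ∀ y, f (W.posterior y) ∈ Set.Icc 0 C := fun y => hf _ (W.posterior_mem_Icc y)
  have hnonneg : ∀ y, 0 ≤ f (W.posterior y) * W.outputProb y := fun y =>
    mul_nonneg (hmem y).1 (W.outputProb_nonneg y)
  have hsummable : Summable fun y => f (W.posterior y) * W.outputProb y :=
    (W.hasSum_outputProb.summable.mul_left C).of_nonneg_of_le hnonneg fun y =>
      mul_le_mul_of_nonneg_right (hmem y).2 (W.outputProb_nonneg y)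
  rw [← (h.resampling.hasSum_tsum_mul_prob hnonneg hsummable.hasSum).tsum_eq]
  exact tsum_congr (h.tsum_posterior_mul_resampling f)

theorem symmCapacity_eq_tsum (W : BIDMC Y) :
    W.symmCapacity
      = ∑' y, (1 - Real.binEntropy (W.posterior y) / Real.log 2) * W.outputProb y := by
  have hlog : Real.log 2 ≠ 0 := (Real.log_pos one_lt_two).ne'
  have hlogb : ∀ x : ℝ, x * Real.logb 2 (2 * x) = x + x * Real.log x / Real.log 2 := fun x => by
    rcases eq_or_ne x 0 with rfl | hx
    · simp
    · rw [Real.logb, Real.log_mul two_ne_zero hx]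
      field_simp
  refine tsum_congr fun y => ?_
  have hout : 1 / 2 * W.prob 0 y + 1 / 2 * W.prob 1 y = W.outputProb y := by
    unfold outputProb
    ring
  rw [Fin.sum_univ_two, hout, prob_zero_eq, prob_one_eq]
  rcases eq_or_ne (W.outputProb y) 0 with h | h
  · simp only [h, mul_zero, zero_mul, add_zero]
  · rw [mul_div_cancel_right₀ _ h, mul_div_cancel_right₀ _ h, Real.binEntropy, Real.log_inv,
      Real.log_inv]
    linear_combination W.outputProb y * (hlogb (W.posterior y) + hlogb (1 - W.posterior y))

theorem Equivalent.symmCapacity_eq (h : W.Equivalent V) : W.symmCapacity = V.symmCapacity := by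
  have hlog : 0 < Real.log 2 := Real.log_pos one_lt_two
  rw [symmCapacity_eq_tsum, symmCapacity_eq_tsum]
  refine h.tsum_posterior_mul_outputProb (f := fun x => 1 - Real.binEntropy x / Real.log 2)
    (C := 1) fun x hx => ⟨sub_nonneg.2 ?_, sub_le_self _ ?_⟩
  · exact (div_le_one hlog).2 Real.binEntropy_le_log_two
  · exact div_nonneg (Real.binEntropy_nonneg hx.1 hx.2) hlog.le

theorem IsDegradationOf.exists_isCoupling [Fintype Y] [Fintype Z] (h : V.IsDegradationOf W) :
    ∃ T : Z → Y → ℝ, IsCoupling T V.outputProb W.outputProb ∧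
      ∀ z, ∑ y, T z y * W.posterior y = V.outputProb z * V.posterior z := by
  obtain ⟨K, hK⟩ := h
  have hK' : ∀ a z, V.prob a z = ∑ y, W.prob a y * K.prob y z := fun a z => by
    rw [hK, tsum_fintype]
  refine ⟨fun z y => W.outputProb y * K.prob y z, ⟨fun z y =>
    mul_nonneg (W.outputProb_nonneg y) (K.nonneg y z), fun z => ?_, fun y => ?_⟩, fun z => ?_⟩
  · rw [outputProb, hK', hK', ← sum_add_distrib, sum_div]
    exact sum_congr rfl fun y _ => by rw [outputProb]; ring
  · rw [← mul_sum, (hasSum_fintype _).unique (K.hasSum_one y), mul_one]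
  · have hV : V.outputProb z * V.posterior z = V.prob 0 z / 2 := by
      rw [prob_zero_eq]
      ring
    rw [hV, hK', sum_div]
    exact sum_congr rfl fun y _ => by rw [prob_zero_eq]; ring

end Posterior

section Mixture

variable {n : ℕ} (p : stdSimplex ℝ (Fin n)) (ε : Fin n → Set.Icc (0 : ℝ) 1)

theorem bscMix_prob (a : Fin 2) (z : Fin n × Fin 2) :
    (bscMix p ε).prob a z = p.1 z.1 * if a = z.2 then 1 - (ε z.1 : ℝ) else ε z.1 :=
  rfl

theorem bscMix_outputProb (z : Fin n × Fin 2) : (bscMix p ε).outputProb z = p.1 z.1 / 2 := by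
  obtain ⟨j, b⟩ := z
  simp only [outputProb, bscMix_prob]
  fin_cases b <;> simp <;> ring

/-- The two outputs of a sub-channel `B(ε j)` have the posterior probabilities `ε j` and
`1 - ε j`. -/
theorem apply_bscMix_posterior {α : Type*} {f : ℝ → α} (hf : ∀ x, f (1 - x) = f x)
    {z : Fin n × Fin 2} (hz : p.1 z.1 ≠ 0) : f ((bscMix p ε).posterior z) = f (ε z.1) := by
  have hsum : (bscMix p ε).prob 0 z + (bscMix p ε).prob 1 z = p.1 z.1 := by
    have hout := bscMix_outputProb p ε z
    rw [outputProb] at hout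
    linarith
  rw [posterior, hsum, bscMix_prob, mul_div_cancel_left₀ _ hz]
  split_ifs
  exacts [hf _, rfl]

variable {p ε} in
theorem bscMix_equivalent {p' : stdSimplex ℝ (Fin n)} {ε' : Fin n → Set.Icc (0 : ℝ) 1}
    (π : Equiv.Perm (Fin n)) (hp : ∀ j, p'.1 j = p.1 (π j))
    (hε : ∀ j, (ε' j : ℝ) = ε (π j) ∨ (ε' j : ℝ) = 1 - ε (π j)) :
    (bscMix p' ε').Equivalent (bscMix p ε) := by
  classical
  refine Equivalent.of_equiv (π.prodShear fun j =>
    if (ε' j : ℝ) = ε (π j) then Equiv.refl _ else Equiv.swap 0 1) fun a z => ?_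
  obtain ⟨j, b⟩ := z
  rw [bscMix_prob, bscMix_prob, hp]
  by_cases h : (ε' j : ℝ) = ε (π j)
  · simp [h]
  · rw [(hε j).resolve_left h]
    fin_cases a <;> fin_cases b <;> simp [h]

theorem bscMix_symmCapacity : (bscMix p ε).symmCapacity
    = 1 - (∑ j, p.1 j * Real.binEntropy (ε j)) / Real.log 2 := by
  have hterm : ∀ z, (1 - Real.binEntropy ((bscMix p ε).posterior z) / Real.log 2)
      * (bscMix p ε).outputProb z
      = (p.1 z.1 - p.1 z.1 * Real.binEntropy (ε z.1) / Real.log 2) / 2 := fun z => by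
    rw [bscMix_outputProb]
    rcases eq_or_ne (p.1 z.1) 0 with h | h
    · simp only [h, zero_div, mul_zero, zero_mul, sub_self]
    · rw [apply_bscMix_posterior p ε Real.binEntropy_one_sub h]
      ring
  rw [symmCapacity_eq_tsum, tsum_fintype, sum_congr rfl fun z _ => hterm z, Fintype.sum_prod_type]
  have hsum : ∑ j, p.1 j = 1 := p.2.2
  simp_rw [Fin.sum_univ_two, add_halves]
  rw [sum_sub_distrib, ← sum_div, hsum]

variable {p ε} in
theorem IsDegradationOf.exists_isCoupling_bscMix {m : ℕ} {q : stdSimplex ℝ (Fin m)}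
    {σ : Fin m → Set.Icc (0 : ℝ) 1} (h : (bscMix p ε).IsDegradationOf (bscMix q σ))
    (hq : ∀ i, q.1 i ≠ 0) :
    ∃ t : Fin n → Fin m → ℝ, IsCoupling t p.1 q.1 ∧
      ∀ j, ∑ i, t j i * min (σ i : ℝ) (1 - σ i) ≤ p.1 j * min (ε j : ℝ) (1 - ε j) := by
  -- Folding the posterior probabilities along the concave map `x ↦ min x (1 - x)` turns the
  -- equality of means into an inequality.
  let f : ℝ → ℝ := fun x => min x (1 - x)
  have hf : ∀ x, f (1 - x) = f x := fun x => by
    simp only [f, sub_sub_cancel, min_comm]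
  have hhalf : ∀ {k : ℕ} (r : stdSimplex ℝ (Fin k)) (δ : Fin k → Set.Icc (0 : ℝ) 1) (j : Fin k),
      ∑ b, (bscMix r δ).outputProb (j, b) = r.1 j := fun r δ j => by
    simp only [bscMix_outputProb, Fin.sum_univ_two, add_halves]
  obtain ⟨T, hT, hmean⟩ := h.exists_isCoupling
  have ht := hT.sum_fst
  simp only [hhalf] at ht
  refine ⟨_, ht, fun j => ?_⟩
  have hrow : ∀ b', ∑ z, T (j, b') z * f (σ z.1) ≤ p.1 j / 2 * f (ε j) := fun b' => by
    have hle : ∑ z, T (j, b') z * f ((bscMix q σ).posterior z)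
        ≤ (bscMix p ε).outputProb (j, b') * f ((bscMix p ε).posterior (j, b')) :=
      hT.sum_mul_min_le (hmean (j, b'))
    simp only [apply_bscMix_posterior q σ hf (hq _), bscMix_outputProb] at hle
    rcases eq_or_ne (p.1 j) 0 with hj | hj
    · simpa only [hj, zero_div, zero_mul] using hle
    · rwa [apply_bscMix_posterior p ε hf hj] at hle
  calc ∑ i, (∑ b', ∑ b, T (j, b') (i, b)) * f (σ i)
      = ∑ b', ∑ z : Fin m × Fin 2, T (j, b') z * f (σ z.1) := by
        simp only [Fintype.sum_prod_type, sum_mul]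
        rw [sum_comm]
    _ ≤ ∑ _b' : Fin 2, p.1 j / 2 * f (ε j) := sum_le_sum fun b' _ => hrow b'
    _ = p.1 j * f (ε j) := by
        rw [Fin.sum_univ_two]
        ring

end Mixture

end Channel

section Boundaries

theorem nth_succ {m : ℕ} (x : Fin m → ℝ) (i : Fin m) : nth x (i + 1) = x i :=
  dif_pos ⟨i.val.succ_pos, i.isLt⟩

theorem nth_zero {m : ℕ} (x : Fin m → ℝ) : nth x 0 = 0 :=
  dif_neg fun h => absurd h.1 (by decide)

theorem nth_of_lt {m : ℕ} (x : Fin m → ℝ) {a : ℕ} (h : m < a) : nth x a = 0 :=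
  dif_neg fun h' => h'.2.not_gt h

theorem nth_mul {m : ℕ} (x y : Fin m → ℝ) (a : ℕ) :
    nth (fun i => x i * y i) a = nth x a * nth y a := by
  unfold nth
  split_ifs
  exacts [rfl, (mul_zero 0).symm]

theorem nth_mem {m : ℕ} {x : Fin m → ℝ} {S : Set ℝ} (h0 : 0 ∈ S) (hx : ∀ i, x i ∈ S) (a : ℕ) :
    nth x a ∈ S := by
  unfold nth
  split_ifs
  exacts [hx _, h0]

theorem sum_segmentWeight_mul (q f : ℕ → ℝ) {l l' : ℕ} (h : l < l') :
    ∑ a ∈ Icc l l', segmentWeight q l l' (q l) (q l') a * f a = ∑ a ∈ Ico l l', q a * f a := by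
  have hlast : segmentWeight q l l' (q l) (q l') l' = 0 := by
    rw [segmentWeight, if_neg h.ne', if_pos rfl, sub_self]
  rw [← Ico_insert_right h.le, sum_insert right_notMem_Ico, hlast, zero_mul, zero_add]
  refine sum_congr rfl fun a ha => congrArg (· * f a) ?_
  obtain ⟨hla, hal⟩ := mem_Ico.1 ha
  rcases hla.eq_or_lt with rfl | hlt
  · exact if_pos rfl
  · rw [segmentWeight, if_neg hlt.ne', if_neg hal.ne, if_pos ⟨hlt, hal⟩]

variable {m n : ℕ}

/-- The number of the first particle in the cluster number `j` of a monotone clustering, where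
particles are counted from `1` and clusters from `0`. -/
def clusterStart (g : Fin m → Fin n) (j : ℕ) : ℕ :=
  #{i | (g i : ℕ) < j} + 1

/-- The splitting positions of a monotone clustering as a P*-degradation: every particle on a
boundary goes to the upper side as a whole. -/
def splitIndex (g : Fin m → Fin n) : ℕ → ℕ
  | 0 => 0
  | j + 1 => clusterStart g (j + 1)

variable {g : Fin m → Fin n}

theorem clusterStart_zero : clusterStart g 0 = 1 := by
  simp [clusterStart]

theorem clusterStart_last : clusterStart g n = m + 1 := by
  simp [clusterStart]

theorem splitIndex_last (hn : 0 < n) : splitIndex g n = m + 1 := by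
  obtain ⟨n, rfl⟩ := Nat.exists_eq_add_one.2 hn
  exact clusterStart_last

variable (hg : Monotone g)

include hg

theorem clusterStart_le_iff {i : Fin m} {j : ℕ} : clusterStart g j ≤ i + 1 ↔ j ≤ g i := by
  rw [clusterStart, add_le_add_iff_right]
  constructor <;> intro h
  · by_contra! hlt
    have hsub : Iic i ⊆ ({l | (g l : ℕ) < j} : Finset (Fin m)) := fun l hl =>
      (mem_filter_univ _).2 ((Fin.le_def.1 (hg (mem_Iic.1 hl))).trans_lt hlt)
    have hcard := card_le_card hsub
    rw [Fin.card_Iic] at hcard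
    omega
  · have hsub : ({l | (g l : ℕ) < j} : Finset (Fin m)) ⊆ Iio i := fun l hl =>
      mem_Iio.2 (hg.reflect_lt (Fin.lt_def.2 (((mem_filter_univ _).1 hl).trans_le h)))
    simpa only [Fin.card_Iio] using card_le_card hsub

theorem Ico_clusterStart (j : Fin n) : Ico (clusterStart g j) (clusterStart g (j + 1))
    = (univ.filter fun i => g i = j).image fun i : Fin m => (i : ℕ) + 1 := by
  have hmem : ∀ i : Fin m,
      (i : ℕ) + 1 ∈ Ico (clusterStart g j) (clusterStart g (j + 1)) ↔ g i = j := fun i => by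
    rw [mem_Ico, ← not_le, clusterStart_le_iff hg, clusterStart_le_iff hg, Fin.ext_iff]
    omega
  have hle : clusterStart g (j + 1) ≤ m + 1 :=
    Nat.succ_le_succ ((card_le_univ _).trans_eq (Fintype.card_fin m))
  ext a
  simp only [mem_image, mem_filter_univ, ← hmem]
  refine ⟨fun ha => ?_, fun ⟨_, hi, hia⟩ => hia ▸ hi⟩
  have hpos : 1 ≤ a := le_trans (Nat.le_add_left _ _) (mem_Ico.1 ha).1
  have hlt := (mem_Ico.1 ha).2
  exact ⟨⟨a - 1, by omega⟩, by rwa [Nat.sub_add_cancel hpos], Nat.sub_add_cancel hpos⟩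

theorem sum_nth_clusterStart (w : Fin m → ℝ) (j : Fin n) :
    ∑ a ∈ Ico (clusterStart g j) (clusterStart g (j + 1)), nth w a = clusterMass w g j := by
  rw [Ico_clusterStart hg, sum_image fun i _ i' _ h => Fin.ext (Nat.succ_injective h)]
  exact sum_congr rfl fun i _ => nth_succ w i

theorem sum_nth_splitIndex (w : Fin m → ℝ) (j : Fin n) :
    ∑ a ∈ Ico (splitIndex g j) (splitIndex g (j + 1)), nth w a = clusterMass w g j := by
  rw [← sum_nth_clusterStart hg]
  obtain ⟨_ | j, hj⟩ := j
  · simp only [zero_add, clusterStart_zero, splitIndex]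
    rw [sum_eq_sum_Ico_succ_bot (show 0 < clusterStart g 1 from Nat.succ_pos _), nth_zero, zero_add]
  · rfl

theorem isDPlus_clusterStart {q σ : Fin m → ℝ} (hq : ∀ i, 0 ≤ q i)
    (hσ : ∀ i, σ i ∈ Set.Icc 0 (1 / 2)) :
    IsDPlus q σ (fun j => clusterStart g j) (clusterMass q g) (clusterMean q σ g) := by
  refine fun j => ⟨fun a _ => nth_mem (Set.left_mem_Icc.2 one_half_pos.le) hσ a,
    (sum_nth_clusterStart hg q j).symm, ?_⟩
  rw [clusterMass_mul_clusterMean hq, ← sum_nth_clusterStart hg]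
  exact sum_congr rfl fun a _ => nth_mul q σ a

variable (hsurj : Function.Surjective g)

include hsurj

theorem clusterStart_lt_succ (j : Fin n) : clusterStart g j < clusterStart g (j + 1) := by
  obtain ⟨i, hi⟩ := hsurj j
  refine nonempty_Ico.1 ?_
  rw [Ico_clusterStart hg]
  exact ⟨_, mem_image_of_mem _ ((mem_filter_univ _).2 hi)⟩

theorem splitIndex_lt_succ (j : Fin n) : splitIndex g j < splitIndex g (j + 1) := by
  obtain ⟨_ | j, hj⟩ := j
  · exact Nat.succ_pos _
  · exact clusterStart_lt_succ hg hsurj ⟨j + 1, hj⟩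

theorem exists_eq_clusterStart (j : Fin n) : ∃ i : Fin m, g i = j ∧ i + 1 = clusterStart g j := by
  have h := left_mem_Ico.2 (clusterStart_lt_succ hg hsurj j)
  rw [Ico_clusterStart hg] at h
  simpa only [mem_image, mem_filter_univ] using h

theorem exists_eq_clusterStart_succ_sub_one (j : Fin n) :
    ∃ i : Fin m, g i = j ∧ i + 1 = clusterStart g (j + 1) - 1 := by
  have hlt := clusterStart_lt_succ hg hsurj j
  have h : clusterStart g (j + 1) - 1 ∈ Ico (clusterStart g j) (clusterStart g (j + 1)) :=
    mem_Ico.2 (by omega)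
  rw [Ico_clusterStart hg] at h
  simpa only [mem_image, mem_filter_univ] using h

theorem isPStarDegradation_of_monotone {q σ : Fin m → ℝ} (hq : ∀ i, 0 < q i)
    (hσ : ∀ i, σ i ∈ Set.Icc 0 (1 / 2)) (hn : 0 < n) (hmean : StrictMono (clusterMean q σ g)) :
    IsPStarDegradation q σ (clusterMass q g) (clusterMean q σ g) := by
  have hq' : ∀ i, 0 ≤ q i := fun i => (hq i).le
  have hpos : ∀ j, 0 < clusterMass q g j := fun j => by
    obtain ⟨i, rfl⟩ := hsurj j
    exact clusterMass_pos hq g i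
  have hsegment : ∀ (j : Fin n) (f : ℕ → ℝ), _ := fun j f =>
    sum_segmentWeight_mul (nth q) f (splitIndex_lt_succ hg hsurj j)
  refine ⟨fun j => splitIndex g j, fun j => nth q (splitIndex g j), rfl, splitIndex_last hn,
    Fin.strictMono_iff_lt_succ.2 fun j => splitIndex_lt_succ hg hsurj j, nth_zero q, ?_,
    fun j => ⟨nth_mem (S := Set.Ici 0) Set.self_mem_Ici hq' _, le_rfl⟩,
    fun j => ⟨fun a _ => nth_mem (Set.left_mem_Icc.2 one_half_pos.le) hσ a, ?_, ?_⟩, hpos, hmean,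
    fun j hj => ?_⟩
  · simp only [Fin.val_last, splitIndex_last hn]
    exact nth_of_lt q (Nat.lt_succ_self m)
  · have hsum := hsegment j fun _ => 1
    simp only [mul_one, sum_nth_splitIndex hg] at hsum
    exact hsum.symm
  · rw [clusterMass_mul_clusterMean hq', ← sum_nth_splitIndex hg]
    exact (sum_congr rfl fun a _ => nth_mul q σ a).trans (hsegment j (nth σ)).symm
  · have hsingle : ∀ w : Fin m → ℝ, clusterMass w g j = nth w (splitIndex g j) := fun w => by
      rw [← sum_nth_splitIndex hg]
      simp only [Fin.val_succ, Fin.val_castSucc] at hj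
      rw [hj, Nat.Ico_succ_singleton, sum_singleton]
    have hne : nth q (splitIndex g j) ≠ 0 := hsingle q ▸ (hpos j).ne'
    refine ⟨fun h => absurd h hne, fun _ => ⟨rfl, hsingle q, ?_⟩⟩
    rw [clusterMean, hsingle, hsingle, nth_mul]
    exact mul_div_cancel_left₀ _ hne

end Boundaries

section Clusterings

variable {m n : ℕ} {q : stdSimplex ℝ (Fin m)} {σ : Fin m → Set.Icc (0 : ℝ) 1}
  {s : Fin m → Fin n}

/-- The weights of the particles compounded along the clustering `s`, as a probability vector. -/
noncomputable def clusterWeights (q : stdSimplex ℝ (Fin m)) (s : Fin m → Fin n) :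
    stdSimplex ℝ (Fin n) :=
  ⟨clusterMass q.1 s, clusterMass_nonneg q.2.1 s, (sum_clusterMass q.1 s).trans q.2.2⟩

/-- The crossover probabilities of the particles compounded along the clustering `s`, as elements
of the unit interval. -/
noncomputable def clusterCenters (q : stdSimplex ℝ (Fin m)) (σ : Fin m → Set.Icc (0 : ℝ) 1)
    (s : Fin m → Fin n) (j : Fin n) : Set.Icc (0 : ℝ) 1 :=
  ⟨clusterMean q.1 (fun i => σ i) s j,
    clusterMean_mem_Icc zero_le_one q.2.1 (fun i => (σ i).2) s j⟩

theorem symmCapacity_bscMix_cluster (q : stdSimplex ℝ (Fin m)) (σ : Fin m → Set.Icc (0 : ℝ) 1)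
    (s : Fin m → Fin n) :
    (Channel.bscMix (clusterWeights q s) (clusterCenters q σ s)).symmCapacity
      = 1 - clusterEntropy q.1 (fun i => (σ i : ℝ)) s / Real.log 2 :=
  Channel.bscMix_symmCapacity _ _

theorem IsMinClustering.nth_lt_phi_lt_nth {q σ : Fin m → ℝ} (hs : IsMinClustering q σ s)
    (hq : ∀ i, 0 < q i) (hσ : ∀ i, σ i ∈ Set.Icc 0 1) (hinj : Function.Injective σ) (hnm : n < m)
    (hmono : Monotone s) {j j' : Fin n} (hj : (j' : ℕ) = j + 1)
    (hpos : 0 < clusterMean q σ s j) (hlt : clusterMean q σ s j < clusterMean q σ s j')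
    (hlt_one : clusterMean q σ s j' < 1) :
    nth σ (clusterStart s j' - 1) < phi (clusterMean q σ s j) (clusterMean q σ s j') ∧
      phi (clusterMean q σ s j) (clusterMean q σ s j') < nth σ (clusterStart s j') := by
  have hcard : Fintype.card (Fin n) < Fintype.card (Fin m) := by simpa using hnm
  have hsurj := hs.surjective hq hσ hinj hcard
  obtain ⟨i, hi, hlast⟩ := exists_eq_clusterStart_succ_sub_one hmono hsurj j
  obtain ⟨i', hi', hfirst⟩ := exists_eq_clusterStart hmono hsurj j'
  rw [← hj] at hlast
  rw [← hlast, ← hfirst, nth_succ, nth_succ]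
  constructor
  · rw [← hi] at hpos hlt ⊢
    exact hs.lt_phi hq hσ hinj hcard hpos hlt hlt_one
  · rw [← hi'] at hlt hlt_one ⊢
    exact hs.phi_lt hq hσ hinj hcard hpos hlt hlt_one

namespace IsCOptimal

variable {X Y : Type*} {Q : BIDMC X} {W : BIDMC Y} (hW : IsCOptimal n q σ Q W)
  (hq : ∀ i, 0 < q.1 i) (hσ : StrictMono σ) (hσ' : ∀ i, (σ i : ℝ) ≤ 1 / 2)
  (hn : 0 < n) (hnm : n < m)

include hW hq hσ hσ' hn hnm

theorem sum_mul_binEntropy_le {p : stdSimplex ℝ (Fin n)} {ε : Fin n → Set.Icc (0 : ℝ) 1}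
    (hWp : W.Equivalent (Channel.bscMix p ε)) (s : Fin m → Fin n) :
    ∑ j, p.1 j * Real.binEntropy (ε j) ≤ clusterEntropy q.1 (fun i => (σ i : ℝ)) s := by
  have : Nonempty (Fin n) := ⟨⟨0, hn⟩⟩
  have hmono : StrictMono fun i => (σ i : ℝ) := hσ
  have hσ₁ : ∀ i, (σ i : ℝ) ∈ Set.Icc 0 1 := fun i => (σ i).2
  have hcard : Fintype.card (Fin n) < Fintype.card (Fin m) := by simpa using hnm
  obtain ⟨s₀, hs₀⟩ := exists_isMinClustering (κ := Fin n) q.1 fun i => (σ i : ℝ)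
  obtain ⟨π, hmin, hmean⟩ := hs₀.exists_perm_strictMono
    (hs₀.clusterMean_injective hq hσ₁ hmono.injective hcard)
  have hPStar := isPStarDegradation_of_monotone (hmin.monotone hq hσ₁ hcard hmono hmean)
    (hmin.surjective hq hσ₁ hmono.injective hcard) hq (fun i => ⟨(σ i).2.1, hσ' i⟩) hn hmean
  have hcap := hW.2.2 (clusterWeights q (π.symm ∘ s₀)) (clusterCenters q σ (π.symm ∘ s₀)) hPStar
  rw [hWp.symmCapacity_eq, symmCapacity_bscMix_cluster, Channel.bscMix_symmCapacity,
    sub_le_sub_iff_left, div_le_div_iff_of_pos_right (Real.log_pos one_lt_two)] at hcap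
  exact hcap.trans (hmin s)

theorem exists_isMinClustering (hQ : Q.Equivalent (Channel.bscMix q σ)) :
    ∃ s : Fin m → Fin n, IsMinClustering q.1 (fun i => (σ i : ℝ)) s ∧
      StrictMono (clusterMean q.1 (fun i => (σ i : ℝ)) s) ∧
      W.Equivalent (Channel.bscMix (clusterWeights q s) (clusterCenters q σ s)) := by
  have hinj : Function.Injective fun i => (σ i : ℝ) := Subtype.val_injective.comp hσ.injective
  have hσ₁ : ∀ i, (σ i : ℝ) ∈ Set.Icc 0 1 := fun i => (σ i).2
  have hcard : Fintype.card (Fin n) < Fintype.card (Fin m) := by simpa using hnm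
  obtain ⟨p, ε, hWp⟩ := hW.1
  have hdeg : (Channel.bscMix p ε).IsDegradationOf (Channel.bscMix q σ) :=
    (hWp.isDegradationOf.trans hW.2.1).trans hQ.symm.isDegradationOf
  obtain ⟨t, ht, hmean⟩ := hdeg.exists_isCoupling_bscMix fun i => (hq i).ne'
  have hmin_σ : ∀ i, min (σ i : ℝ) (1 - σ i) = σ i := fun i =>
    min_eq_left (by linarith [hσ' i])
  simp only [hmin_σ] at hmean
  have hfold : ∀ j, min (ε j : ℝ) (1 - ε j) ∈ Set.Icc 0 (1 / 2) := fun j =>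
    ⟨le_min (ε j).2.1 (sub_nonneg.2 (ε j).2.2), min_le_iff.2 (by
      by_contra! h
      linarith)⟩
  have hbest : ∀ s : Fin m → Fin n, ∑ j, p.1 j * Real.binEntropy (min (ε j : ℝ) (1 - ε j))
      ≤ clusterEntropy q.1 (fun i => (σ i : ℝ)) s := fun s => by
    have hentropy : ∀ x, Real.binEntropy (min x (1 - x)) = Real.binEntropy x := fun x => by
      rcases min_choice x (1 - x) with h | h <;> rw [h]
      exact Real.binEntropy_one_sub x
    simpa only [hentropy] using hW.sum_mul_binEntropy_le hq hσ hσ' hn hnm hWp s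
  obtain ⟨s, hs, hp, hε⟩ := ht.exists_isMinClustering hq hσ₁ hinj hcard hfold hmean hbest
  obtain ⟨π, hmin, hsm⟩ := hs.exists_perm_strictMono (hs.clusterMean_injective hq hσ₁ hinj hcard)
  refine ⟨π.symm ∘ s, hmin, hsm,
    hWp.trans (Channel.bscMix_equivalent π (fun j => ?_) fun j => ?_).symm⟩
  · rw [hp]
    exact clusterMass_perm q.1 s π j
  · have hcenter : (clusterCenters q σ (π.symm ∘ s) j : ℝ) = min (ε (π j) : ℝ) (1 - ε (π j)) :=
      (clusterMean_perm _ _ s π j).trans (congrFun hε (π j)).symm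
    rw [hcenter]
    exact min_choice _ _

end IsCOptimal

end Clusterings

theorem theorem5 {m n : ℕ} (hn : 2 ≤ n) (hnm : n < m)
    (q : stdSimplex ℝ (Fin m)) (σ : Fin m → Set.Icc (0 : ℝ) 1)
    (hq : ∀ i, 0 < q.1 i) (hσ : StrictMono σ) (hσ' : ∀ i, (σ i : ℝ) ≤ 1 / 2)
    {X Y : Type*} (Q : BIDMC X) (hQ : Q.Equivalent (Channel.bscMix q σ))
    (W : BIDMC Y) (hW : IsCOptimal n q σ Q W) :
    ∃ k : Fin (n + 1) → ℕ, k 0 = 1 ∧ k (Fin.last n) = m + 1 ∧ StrictMono k ∧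
      ∃ (p : stdSimplex ℝ (Fin n)) (ε : Fin n → Set.Icc (0 : ℝ) 1),
        IsDPlus q.1 (fun i => (σ i : ℝ)) k p.1 (fun j => (ε j : ℝ)) ∧
        W.Equivalent (Channel.bscMix p ε) ∧
        ∀ (j : ℕ) (hj : j + 1 < n), 0 < (ε ⟨j, by omega⟩ : ℝ) →
          nth (fun i => (σ i : ℝ)) (k ⟨j + 1, by omega⟩ - 1)
              < phi (ε ⟨j, by omega⟩) (ε ⟨j + 1, hj⟩) ∧
            phi (ε ⟨j, by omega⟩) (ε ⟨j + 1, hj⟩)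
              < nth (fun i => (σ i : ℝ)) (k ⟨j + 1, by omega⟩) := by
  have hinj : Function.Injective fun i => (σ i : ℝ) := Subtype.val_injective.comp hσ.injective
  have hσ₁ : ∀ i, (σ i : ℝ) ∈ Set.Icc 0 1 := fun i => (σ i).2
  have hσ₂ : ∀ i, (σ i : ℝ) ∈ Set.Icc 0 (1 / 2) := fun i => ⟨(σ i).2.1, hσ' i⟩
  have hcard : Fintype.card (Fin n) < Fintype.card (Fin m) := by simpa using hnm
  obtain ⟨s, hs, hmean, hWs⟩ := hW.exists_isMinClustering hq hσ hσ' (by omega) hnm hQ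
  have hmono : Monotone s := hs.monotone hq hσ₁ hcard (fun _ _ h => hσ h) hmean
  have hsurj : Function.Surjective s := hs.surjective hq hσ₁ hinj hcard
  have hlt_one : ∀ j, clusterMean q.1 (fun i => (σ i : ℝ)) s j < 1 := fun j =>
    (clusterMean_mem_Icc one_half_pos.le q.2.1 hσ₂ s j).2.trans_lt one_half_lt_one
  exact ⟨fun j => clusterStart s j, clusterStart_zero, clusterStart_last,
    Fin.strictMono_iff_lt_succ.2 (clusterStart_lt_succ hmono hsurj),
    clusterWeights q s, clusterCenters q σ s, isDPlus_clusterStart hmono q.2.1 hσ₂, hWs,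
    fun j hj hpos => hs.nth_lt_phi_lt_nth hq hσ₁ hinj hnm hmono (j' := ⟨j + 1, hj⟩)
      rfl hpos (hmean (Fin.mk_lt_mk.2 j.lt_succ_self)) (hlt_one _)⟩
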